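/- Let $f_0$ be a positive function on $[0,1]^d$. Let $X_1,\dots,X_n$ be (random or deterministic) design points in $[0,1]^d$, and let $Y=(Y_1,\dots,Y_n)^T$ be counts which, conditionally on $X_1,\dots,X_n$, are independent with $Y_i\sim\mathrm{Poisson}(f_0(X_i))$. Write $\mathbb P$ and $\mathbb E$ for probability and expectation conditionally on $X_1,\dots,X_n$. Let $\varphi_1,\dots,\varphi_p$ be real functions on $\mathbb R^d$, let $A=(\varphi_j(X_i))_{1\le i\le n,\,1\le j\le p}$, let $\{1,\dots,p\}=G_1\sqcup\dots\sqcup G_K$ be a partition into non-empty groups, and let $A_{G_k}$ be the submatrix of $A$ with the columns indexed by $G_k$. Fix $k\in\{1,\dots,K\}$ and $\gamma>0$, and assume that there is $M>0$ with $|f_0(x)|\le M$ for all $x\in[0,1]^d$. Assume also that $A_{G_k}\neq 0$. Set $$c_k=\sup_{x\in\mathbb R^n,\ A_{G_k}^Tx\ne 0}\frac{\|A_{G_k}A_{G_k}^Tx\|_2}{\|A_{G_k}^Tx\|_2},\qquad b_k=\max_{1\le i\le n}\sqrt{\sum_{j\in G_k}\varphi_j^2(X_i)},\qquad D_k=8Mc_k^2+16b_k^2\gamma\log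 p,$$ and, for $j\in G_k$, $\widehat V_j=\sum_{i=1}^n\varphi_j^2(X_i)Y_i$ and $$\widetilde V_j^g=\widehat V_j+\sqrt{2(\gamma\log p+\log|G_k|)\,\widehat V_j\max_i\varphi_j^2(X_i)}+3(\gamma\log p+\log|G_k|)\max_i\varphi_j^2(X_i).$$ Finally, let $$\lambda_k^g=\Bigl(1+\frac{1}{2\sqrt{2\gamma\log p}}\Bigr)\sqrt{\sum_{j\in G_k}\widetilde V_j^g}+2\sqrt{\gamma\log p\,D_k}.$$ Then, almost surely with respect to the design, $$\mathbb P\Bigl(\|A_{G_k}^T(Y-\mathbb E[Y])\|_2\ge\lambda_k^g\Bigr)\le\frac{2}{p^\gamma}.$$ (For $p=1$ the weight is undefined or infinite and the bound is trivial.) -/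

import Mathlib

open MeasureTheory ProbabilityTheory
open scoped Matrix

noncomputable section

namespace PoissonGroupLasso

/-- The Euclidean norm of a finite real vector. -/
def l2norm {ι : Type*} [Fintype ι] (v : ι → ℝ) : ℝ := ‖WithLp.toLp 2 v‖

/-- Functional Poisson regression: the design points `X i` lie in `[0,1]^d` almost surely and,
conditionally on the whole design `(X i)`, the counts `Y i` are independent with
`Y i ∼ Poisson (f₀ (X i))`. A deterministic design is the special case of constant `X i`
(then `condDistrib` at the design is the law of `Y`). -/
structure IsPoissonRegression {Ω : Type*} [MeasurableSpace Ω] (P : Measure Ω)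
    [IsProbabilityMeasure P] {n d : ℕ} (f₀ : (Fin d → ℝ) → ℝ)
    (X : Ω → Fin n → Fin d → ℝ) (Y : Ω → Fin n → ℕ) : Prop where
  measurable_design : Measurable X
  measurable_counts : Measurable Y
  mem_cube : ∀ᵐ ω ∂P, ∀ i, X ω i ∈ Set.Icc (0 : Fin d → ℝ) 1
  condLaw : ∀ᵐ x ∂(P.map X),
    condDistrib Y X P x = Measure.pi (fun i => poissonMeasure (f₀ (x i)).toNNReal)

/-- Deterministic designs with independent Poisson counts are covered by the model. -/
theorem IsPoissonRegression.of_fixed {Ω : Type*} [MeasurableSpace Ω] (P : Measure Ω)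
    [IsProbabilityMeasure P] {n d : ℕ} (f₀ : (Fin d → ℝ) → ℝ) (x₀ : Fin n → Fin d → ℝ)
    (hx₀ : ∀ i, x₀ i ∈ Set.Icc (0 : Fin d → ℝ) 1) (Y : Ω → Fin n → ℕ) (hY : Measurable Y)
    (hlaw : P.map Y = Measure.pi (fun i => poissonMeasure (f₀ (x₀ i)).toNNReal)) :
    IsPoissonRegression P f₀ (fun _ => x₀) Y := by
  refine ⟨measurable_const, hY, .of_forall fun _ => hx₀, ?_⟩
  have h : condDistrib Y (fun _ => x₀) P x₀ = P.map Y := by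
    ext s hs
    rw [condDistrib_apply_of_ne_zero hY _ (by simp [Measure.map_const]),
      Measure.map_apply (by fun_prop) ((measurableSet_singleton _).prod hs),
      Measure.map_apply hY hs]
    simp [Measure.map_const, Set.mk_preimage_prod]
  rw [Measure.map_const]
  simp [ae_dirac_eq, h, hlaw]

/-- The `n × p` design matrix `A i j = φ j (x i)`. -/
def designMatrix {n d p : ℕ} (φ : Fin p → (Fin d → ℝ) → ℝ) (x : Fin n → Fin d → ℝ) :
    Matrix (Fin n) (Fin p) ℝ :=
  Matrix.of fun i j => φ j (x i)

/-- The submatrix `A_G` of the columns of `A` indexed by `G`. -/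
def groupMatrix {n p : ℕ} (A : Matrix (Fin n) (Fin p) ℝ) (G : Finset (Fin p)) :
    Matrix (Fin n) G ℝ :=
  A.submatrix id (fun j => (j : Fin p))

/-- `c = sup_v ‖A_G A_Gᵀ v‖₂ / ‖A_Gᵀ v‖₂`, over the `v` for which the quotient makes sense. -/
def cConst {n p : ℕ} (A : Matrix (Fin n) (Fin p) ℝ) (G : Finset (Fin p)) : ℝ :=
  sSup ((fun v : Fin n → ℝ =>
      l2norm ((groupMatrix A G * (groupMatrix A G)ᵀ) *ᵥ v) / l2norm ((groupMatrix A G)ᵀ *ᵥ v)) ''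
    {v | (groupMatrix A G)ᵀ *ᵥ v ≠ 0})

/-- `b = max_i √(∑_{j ∈ G} A i j ^ 2)`. -/
def bConst {n p : ℕ} (A : Matrix (Fin n) (Fin p) ℝ) (G : Finset (Fin p)) : ℝ :=
  ⨆ i : Fin n, √(∑ j ∈ G, A i j ^ 2)

/-- The unbiased variance estimate `V̂ j = ∑_i A i j ^ 2 * Y i`. -/
def varHat {n p : ℕ} (A : Matrix (Fin n) (Fin p) ℝ) (y : Fin n → ℕ) (j : Fin p) : ℝ :=
  ∑ i, A i j ^ 2 * (y i : ℝ)

/-- The inflated variance estimate `Ṽ j ^ g`, with `u = γ log p + log |G|`. -/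
def varTilde {n p : ℕ} (A : Matrix (Fin n) (Fin p) ℝ) (G : Finset (Fin p)) (γ : ℝ)
    (y : Fin n → ℕ) (j : Fin p) : ℝ :=
  varHat A y j
    + √(2 * (γ * Real.log p + Real.log G.card) * varHat A y j * ⨆ i : Fin n, A i j ^ 2)
    + 3 * (γ * Real.log p + Real.log G.card) * ⨆ i : Fin n, A i j ^ 2

/-- `D = 8 M c² + 16 b² γ log p`. -/
def dConst {n p : ℕ} (A : Matrix (Fin n) (Fin p) ℝ) (G : Finset (Fin p)) (M γ : ℝ) : ℝ :=
  8 * M * cConst A G ^ 2 + 16 * bConst A G ^ 2 * γ * Real.log p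

/-- The data-driven group weight `λ ^ g`, computed from the observed counts `y`. -/
def groupWeight {n p : ℕ} (A : Matrix (Fin n) (Fin p) ℝ) (G : Finset (Fin p)) (M γ : ℝ)
    (y : Fin n → ℕ) : ℝ :=
  (1 + 1 / (2 * √(2 * γ * Real.log p))) * √(∑ j ∈ G, varTilde A G γ y j)
    + 2 * √(γ * Real.log p * dConst A G M γ)

/-- The mean vector of a law of counts. -/
def meanVec {n : ℕ} (Q : Measure (Fin n → ℕ)) (i : Fin n) : ℝ := ∫ y, (y i : ℝ) ∂Q

end PoissonGroupLasso

end

/-! Fix the design and write θ for the Poisson means, S = A_Gᵀ(Y − θ), V_j for the variance of the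
j-th coordinate of S, V = ∑_{j ∈ G} V_j = E‖S‖² and u = γ log p. For p > 1, two exceptional events,
each of probability at most exp(-u) = p^(-γ), account for the bound 2 / p^γ. Off the first, ‖S‖ < (1
+ 1/(2√(2u)))√V + 2√(uD). Off the second, Ṽ_j ≥ V_j for all j ∈ G, so the observable weight is at
least that oracle threshold.

The first event is handled by the entropy method. A Poisson law is a convolution of many Poisson(ε)
laws, each concentrated on {0, 1} up to mass O(ε²); summing their entropies gives a modified
logarithmic Sobolev inequality (`entropy_poissonMeasure_le`), which tensorizes
(`entropy_poissonPi_le`). Herbst's argument then yields `poissonPi_deviation`. It is applied in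
`l2norm_deviation` to ‖S‖ truncated from below at a multiple T of √V. Adding a count at site i adds
the row a_i to S and moves the truncated norm by at most |2⟨S, a_i⟩ + ‖a_i‖²| / max(‖S‖, T). The
inner products sum to ‖A_G S‖² ≤ c²‖S‖², the squares contribute a multiple of b²V/T², that is of
b²u, and these are the two terms of D.

The second event is a union bound over G of Chernoff lower tails for the V̂_j
(`poissonPi_lower_tail`); solving a quadratic inequality in √V_j turns each into a bound by Ṽ_j. -/

namespace PoissonGroupLasso

open Filter Topology

/-! ### Bregman divergence and entropy on discrete spaces -/

/-- The Bregman divergence of `x ↦ x log x`. -/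
noncomputable def bregman (a b : ℝ) : ℝ := a * (Real.log a - Real.log b) - a + b

/-- The entropy functional of a positive function. -/
noncomputable def entropy {α : Type*} [MeasurableSpace α] (μ : Measure α) (g : α → ℝ) : ℝ :=
  ∫ x, g x * Real.log (g x) ∂μ - (∫ x, g x ∂μ) * Real.log (∫ x, g x ∂μ)

/-- The divergence is a supremum of functions affine in (a, b), attained at c = a / b. Joint
convexity, hence Jensen's inequality, comes from this. -/
theorem bregman_ge {a b c : ℝ} (ha : 0 < a) (hb : 0 < b) (hc : 0 < c) :
    a * Real.log c - b * c + b ≤ bregman a b := by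
  have h := Real.log_le_sub_one_of_pos (x := b * c / a) (by positivity)
  rw [Real.log_div (by positivity) ha.ne', Real.log_mul hb.ne' hc.ne'] at h
  have h2 := mul_le_mul_of_nonneg_left h ha.le
  have h3 : a * (b * c / a - 1) = b * c - a := by field_simp
  rw [h3] at h2
  unfold bregman
  linarith

theorem bregman_nonneg {a b : ℝ} (ha : 0 < a) (hb : 0 < b) : 0 ≤ bregman a b := by
  have := bregman_ge ha hb one_pos
  simpa using this

theorem bregman_self (a : ℝ) : bregman a a = 0 := by simp [bregman]

theorem bregman_le {m C a b : ℝ} (hm : 0 < m) (ha : a ∈ Set.Icc m C) (hb : b ∈ Set.Icc m C) :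
    bregman a b ≤ C * (Real.log C - Real.log m) + C := by
  have h1 : Real.log a ≤ Real.log C := Real.log_le_log (hm.trans_le ha.1) ha.2
  have h2 : Real.log m ≤ Real.log b := Real.log_le_log hm hb.1
  have h3 : Real.log m ≤ Real.log C := Real.log_le_log hm (ha.1.trans ha.2)
  have h4 : a * (Real.log a - Real.log b) ≤ a * (Real.log C - Real.log m) :=
    mul_le_mul_of_nonneg_left (by linarith) (hm.trans_le ha.1).le
  have h5 : a * (Real.log C - Real.log m) ≤ C * (Real.log C - Real.log m) :=
    mul_le_mul_of_nonneg_right ha.2 (by linarith)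
  unfold bregman
  linarith [ha.1, hb.2]

theorem bregman_exp (s t : ℝ) :
    bregman (Real.exp s) (Real.exp t) =
      Real.exp t * ((s - t) * Real.exp (s - t) - Real.exp (s - t) + 1) := by
  have : Real.exp s = Real.exp t * Real.exp (s - t) := by rw [← Real.exp_add]; ring_nf
  unfold bregman
  rw [Real.log_exp, Real.log_exp, this]
  ring

section Discrete

variable {α β : Type*} [MeasurableSpace α] [DiscreteMeasurableSpace α]
  [MeasurableSpace β] [DiscreteMeasurableSpace β]

theorem integrable_of_mem_Icc (μ : Measure α) [IsFiniteMeasure μ] {g : α → ℝ} {m C : ℝ}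
    (h : ∀ x, g x ∈ Set.Icc m C) : Integrable g μ :=
  .of_mem_Icc m C (Measurable.of_discrete.aemeasurable) (.of_forall h)

theorem integral_mem_Icc (μ : Measure α) [IsProbabilityMeasure μ] {g : α → ℝ} {m C : ℝ}
    (h : ∀ x, g x ∈ Set.Icc m C) : ∫ x, g x ∂μ ∈ Set.Icc m C := by
  constructor
  · simpa using integral_mono (μ := μ) (integrable_const m) (integrable_of_mem_Icc μ h)
      fun x => (h x).1
  · simpa using integral_mono (μ := μ) (integrable_of_mem_Icc μ h) (integrable_const C)
      fun x => (h x).2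

theorem mul_log_mem_Icc {m C a : ℝ} (hm : 0 < m) (ha : a ∈ Set.Icc m C) :
    a * Real.log a ∈ Set.Icc (-1) (C * C) := by
  have h0 := hm.trans_le ha.1
  have h1 := Real.log_le_sub_one_of_pos h0
  have h2 := Real.log_le_sub_one_of_pos (inv_pos.2 h0)
  rw [Real.log_inv] at h2
  have h3 : a * (a⁻¹ - 1) = 1 - a := by field_simp
  constructor
  · nlinarith [mul_le_mul_of_nonneg_left h2 h0.le]
  · have : a * Real.log a ≤ a * C := mul_le_mul_of_nonneg_left (by linarith [ha.2]) h0.le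
    have : a * C ≤ C * C := mul_le_mul_of_nonneg_right ha.2 (by linarith [ha.2])
    linarith

theorem integrable_mul_log (μ : Measure α) [IsFiniteMeasure μ] {g : α → ℝ} {m C : ℝ}
    (hm : 0 < m) (h : ∀ x, g x ∈ Set.Icc m C) :
    Integrable (fun x => g x * Real.log (g x)) μ :=
  integrable_of_mem_Icc μ fun x => mul_log_mem_Icc hm (h x)

theorem bregman_mem_Icc {m C a b : ℝ} (hm : 0 < m) (ha : a ∈ Set.Icc m C) (hb : b ∈ Set.Icc m C) :
    bregman a b ∈ Set.Icc 0 (C * (Real.log C - Real.log m) + C) :=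
  ⟨bregman_nonneg (hm.trans_le ha.1) (hm.trans_le hb.1), bregman_le hm ha hb⟩

theorem integrable_bregman (μ : Measure α) [IsFiniteMeasure μ] {g k : α → ℝ} {m C : ℝ}
    (hm : 0 < m) (hg : ∀ x, g x ∈ Set.Icc m C) (hk : ∀ x, k x ∈ Set.Icc m C) :
    Integrable (fun x => bregman (g x) (k x)) μ :=
  integrable_of_mem_Icc μ fun x => bregman_mem_Icc hm (hg x) (hk x)

/-- The two sides differ by exactly `bregman (∫ g) c`, which is nonnegative. -/
theorem entropy_le_integral_bregman (μ : Measure α) [IsProbabilityMeasure μ] {g : α → ℝ}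
    {m C c : ℝ} (hm : 0 < m) (hg : ∀ x, g x ∈ Set.Icc m C) (hc : c ∈ Set.Icc m C) :
    entropy μ g ≤ ∫ x, bregman (g x) c ∂μ := by
  have h1 : ∫ x, bregman (g x) c ∂μ =
      ∫ x, g x * Real.log (g x) ∂μ - (∫ x, g x ∂μ) * Real.log c - (∫ x, g x ∂μ) + c := by
    have : (fun x => bregman (g x) c) =
        fun x => g x * Real.log (g x) - g x * Real.log c - g x + c := by
      ext x; unfold bregman; ring
    have i1 := integrable_mul_log μ hm hg
    have i2 := integrable_of_mem_Icc μ hg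
    have i3 : Integrable (fun x => g x * Real.log (g x) - g x * Real.log c) μ :=
      i1.sub (i2.mul_const _)
    have i4 : Integrable (fun x => g x * Real.log (g x) - g x * Real.log c - g x) μ := i3.sub i2
    rw [this, integral_add i4 (integrable_const _), integral_sub i3 i2,
      integral_sub i1 (i2.mul_const _), integral_mul_const]
    simp
  have h2 : 0 ≤ bregman (∫ x, g x ∂μ) c :=
    bregman_nonneg (hm.trans_le (integral_mem_Icc μ hg).1) (hm.trans_le hc.1)
  unfold bregman at h2
  unfold entropy
  linarith

/-- Jensen for the jointly convex divergence: integrate the affine minorant that is tight at the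
pair of means. -/
theorem bregman_integral_le (μ : Measure α) [IsProbabilityMeasure μ] {g k : α → ℝ} {m C : ℝ}
    (hm : 0 < m) (hg : ∀ x, g x ∈ Set.Icc m C) (hk : ∀ x, k x ∈ Set.Icc m C) :
    bregman (∫ x, g x ∂μ) (∫ x, k x ∂μ) ≤ ∫ x, bregman (g x) (k x) ∂μ := by
  have ga := hm.trans_le (integral_mem_Icc μ hg).1
  have ka := hm.trans_le (integral_mem_Icc μ hk).1
  set a := ∫ x, g x ∂μ with ha
  set b := ∫ x, k x ∂μ with hb
  have hc : 0 < a / b := by positivity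
  have i1 := integrable_of_mem_Icc μ hg
  have i2 := integrable_of_mem_Icc μ hk
  have i3 : Integrable (fun x => g x * Real.log (a / b) - k x * (a / b)) μ :=
    (i1.mul_const _).sub (i2.mul_const _)
  have h := integral_mono (μ := μ) (i3.add i2)
    (integrable_bregman μ hm hg hk)
    (fun x => bregman_ge (hm.trans_le (hg x).1) (hm.trans_le (hk x).1) hc)
  refine le_of_eq_of_le ?_ h
  simp only [Pi.add_apply]
  rw [integral_add i3 i2,
    integral_sub (i1.mul_const _) (i2.mul_const _), integral_mul_const, integral_mul_const,
    ← ha, ← hb, Real.log_div ga.ne' ka.ne', mul_div_cancel₀ _ ka.ne']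
  unfold bregman
  ring

/-- Chain rule for entropy; it drives both the convolution induction and the tensorization. -/
theorem entropy_prod [Countable α] [Countable β] (μ : Measure α) [IsProbabilityMeasure μ]
    (ν : Measure β) [IsProbabilityMeasure ν] {g : α → β → ℝ} {m C : ℝ} (hm : 0 < m)
    (hg : ∀ x y, g x y ∈ Set.Icc m C) :
    entropy (μ.prod ν) (fun z => g z.1 z.2) =
      entropy μ (fun x => ∫ y, g x y ∂ν) + ∫ x, entropy ν (g x) ∂μ := by
  have i1 : Integrable (fun z : α × β => g z.1 z.2) (μ.prod ν) :=
    integrable_of_mem_Icc _ fun z => hg z.1 z.2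
  have i2 := integrable_mul_log (μ.prod ν) hm (g := fun z : α × β => g z.1 z.2)
    fun z => hg z.1 z.2
  have h1 := integral_prod _ i1
  have h2 := integral_prod _ i2
  simp only at h1 h2
  unfold entropy
  rw [h1, h2, integral_sub]
  · ring
  · exact integrable_of_mem_Icc μ fun x => integral_mem_Icc ν fun y => mul_log_mem_Icc hm (hg x y)
  · exact integrable_mul_log μ hm fun x => integral_mem_Icc ν (hg x)

end Discrete

/-! ### Modified logarithmic Sobolev inequality for one Poisson law -/

theorem integral_poissonMeasure_mono {r s : NNReal} (hrs : r ≤ s) {h : ℕ → ℝ} {C : ℝ}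
    (hh : ∀ x, h x ∈ Set.Icc 0 C) :
    ∫ x, h x ∂(poissonMeasure r) ≤ Real.exp (s - r) * ∫ x, h x ∂(poissonMeasure s) := by
  refine hasSum_le ?_
    (hasSum_integral_poissonMeasure (r := r) (integrable_of_mem_Icc (poissonMeasure r) hh))
    ((hasSum_integral_poissonMeasure (r := s)
      (integrable_of_mem_Icc (poissonMeasure s) hh)).mul_left (Real.exp (s - r)))
  intro k
  have hp : (r : ℝ) ^ k ≤ (s : ℝ) ^ k := pow_le_pow_left₀ r.2 (by exact_mod_cast hrs) k
  have he : Real.exp (s - r) * Real.exp (-s) = Real.exp (-r) := by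
    rw [← Real.exp_add]; ring_nf
  simp only [smul_eq_mul]
  have : Real.exp (s - r) * (Real.exp (-s) * s ^ k / (k.factorial : ℝ) * h k)
      = Real.exp (-r) * s ^ k / (k.factorial : ℝ) * h k := by rw [← he]; ring
  rw [this]
  have := (hh k).1
  gcongr

/-- The point 0 contributes nothing, the point 1 has mass at most r, and the remaining points have
total mass at most r². -/
theorem integral_poissonMeasure_le_of_zero (r : NNReal) {h : ℕ → ℝ} {C : ℝ} (h0 : h 0 = 0)
    (hh : ∀ x, h x ∈ Set.Icc 0 C) :
    ∫ x, h x ∂(poissonMeasure r) ≤ r * h 1 + C * r ^ 2 := by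
  have hC : 0 ≤ C := (hh 0).1.trans (hh 0).2
  have p0 : (poissonMeasure r).real {0} = Real.exp (-r) := by
    simp [poissonMeasure_real_singleton]
  have p1 : (poissonMeasure r).real {1} = Real.exp (-r) * r := by
    simp [poissonMeasure_real_singleton]
  have i0 : Integrable (Set.indicator ({0} : Set ℕ) (fun _ => (1 : ℝ))) (poissonMeasure r) :=
    (integrable_const _).indicator (.of_discrete)
  have i1 : Integrable (Set.indicator ({1} : Set ℕ) (fun _ => (1 : ℝ))) (poissonMeasure r) :=
    (integrable_const _).indicator (.of_discrete)
  have i2 : Integrable (fun x => 1 - Set.indicator ({0} : Set ℕ) (fun _ => (1 : ℝ)) x)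
      (poissonMeasure r) := (integrable_const 1).sub i0
  have i3 : Integrable (fun x => 1 - Set.indicator ({0} : Set ℕ) (fun _ => (1 : ℝ)) x -
      Set.indicator ({1} : Set ℕ) (fun _ => (1 : ℝ)) x) (poissonMeasure r) := i2.sub i1
  have key : ∫ x, h x ∂(poissonMeasure r) ≤
      ∫ x, (Set.indicator ({1} : Set ℕ) (fun _ => (1 : ℝ)) x * h 1 +
        (1 - Set.indicator ({0} : Set ℕ) (fun _ => (1 : ℝ)) x
          - Set.indicator ({1} : Set ℕ) (fun _ => (1 : ℝ)) x) * C) ∂(poissonMeasure r) := by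
    refine integral_mono (integrable_of_mem_Icc _ hh)
      ((i1.mul_const _).add (i3.mul_const C)) ?_
    intro x
    rcases x with _ | _ | x
    · simp [h0]
    · simp
    · simpa using (hh _).2
  rw [integral_add (i1.mul_const _) (i3.mul_const C),
    integral_mul_const, integral_mul_const, integral_sub i2 i1,
    integral_sub (integrable_const 1) i0, integral_indicator_const _ .of_discrete,
    integral_indicator_const _ .of_discrete, p0, p1] at key
  simp at key
  have e1 : Real.exp (-r) ≤ 1 := by simp
  have e2 : 1 - (r : ℝ) ≤ Real.exp (-r) := by linarith [Real.add_one_le_exp (-(r : ℝ))]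
  have hr : (0 : ℝ) ≤ r := r.2
  have a1 : Real.exp (-r) * r * h 1 ≤ r * h 1 := by
    have : Real.exp (-r) * (r * h 1) ≤ 1 * (r * h 1) :=
      mul_le_mul_of_nonneg_right e1 (mul_nonneg hr (hh 1).1)
    linarith
  have a2 : (1 - Real.exp (-r) - Real.exp (-r) * r) * C ≤ C * r ^ 2 := by
    have : 1 - Real.exp (-r) - Real.exp (-r) * r ≤ r ^ 2 := by nlinarith
    nlinarith
  linarith

/-- Induction on the number of Poisson(ε) summands: the chain rule splits off one summand, whose
entropy is at most ε times a single divergence plus an O(ε²) error. -/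
theorem entropy_poissonMeasure_nat_mul_le (ε : NNReal) {m C : ℝ} (hm : 0 < m) (N : ℕ) :
    ∀ g : ℕ → ℝ, (∀ x, g x ∈ Set.Icc m C) →
      entropy (poissonMeasure (N * ε)) g ≤
        N * (ε * Real.exp ε * ∫ x, bregman (g (x + 1)) (g x) ∂(poissonMeasure (N * ε)) +
          (C * (Real.log C - Real.log m) + C) * ε ^ 2) := by
  set K := C * (Real.log C - Real.log m) + C with hK
  have small : ∀ (r : NNReal) (g : ℕ → ℝ), (∀ x, g x ∈ Set.Icc m C) →
      entropy (poissonMeasure r) g ≤ r * bregman (g 1) (g 0) + K * r ^ 2 := by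
    intro r g hg
    refine (entropy_le_integral_bregman _ hm hg (hg 0)).trans ?_
    exact integral_poissonMeasure_le_of_zero r (h := fun x => bregman (g x) (g 0))
      (bregman_self _) fun x => bregman_mem_Icc hm (hg x) (hg 0)
  induction N with
  | zero => intro g hg; simpa using small 0 g hg
  | succ N ih =>
    intro g hg
    have hconv : poissonMeasure ((N + 1 : ℕ) * ε) =
        poissonMeasure (N * ε) ∗ poissonMeasure ε := by
      rw [poissonMeasure_conv_poissonMeasure]; congr 1; push_cast; ring
    have hint : ∀ h : ℕ → ℝ, ∀ a b : ℝ, (∀ x, h x ∈ Set.Icc a b) →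
        ∫ x, h x ∂(poissonMeasure ((N + 1 : ℕ) * ε)) =
          ∫ x, ∫ y, h (x + y) ∂(poissonMeasure ε) ∂(poissonMeasure (N * ε)) := by
      intro h a b hh
      rw [hconv]
      exact integral_conv (integrable_of_mem_Icc _ hh)
    have hent : entropy (poissonMeasure ((N + 1 : ℕ) * ε)) g =
        entropy (poissonMeasure (N * ε)) (fun x => ∫ y, g (x + y) ∂(poissonMeasure ε)) +
          ∫ x, entropy (poissonMeasure ε) (fun y => g (x + y)) ∂(poissonMeasure (N * ε)) := by
      rw [← entropy_prod _ _ hm (fun x y => hg (x + y))]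
      have e1 := integral_prod (μ := poissonMeasure (N * ε)) (ν := poissonMeasure ε)
        (fun z : ℕ × ℕ => g (z.1 + z.2)) (integrable_of_mem_Icc _ fun z => hg _)
      have e2 := integral_prod (μ := poissonMeasure (N * ε)) (ν := poissonMeasure ε)
        (fun z : ℕ × ℕ => g (z.1 + z.2) * Real.log (g (z.1 + z.2)))
        (integrable_of_mem_Icc _ fun z => mul_log_mem_Icc hm (hg _))
      unfold entropy
      rw [e1, e2, hint g _ _ hg, hint _ _ _ fun x => mul_log_mem_Icc hm (hg x)]
    have hB : ∀ x, bregman (g (x + 1)) (g x) ∈ Set.Icc 0 K :=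
      fun x => bregman_mem_Icc hm (hg _) (hg _)
    -- Induction hypothesis for g averaged over the last summand; Jensen moves the average outside
    -- the divergence.
    have step1 : entropy (poissonMeasure (N * ε)) (fun x => ∫ y, g (x + y) ∂(poissonMeasure ε)) ≤
        N * (ε * Real.exp ε *
          ∫ x, bregman (g (x + 1)) (g x) ∂(poissonMeasure ((N + 1 : ℕ) * ε)) + K * ε ^ 2) := by
      refine (ih _ fun x => integral_mem_Icc _ fun y => hg _).trans ?_
      gcongr
      rw [hint _ _ _ hB]
      refine integral_mono
        (integrable_bregman _ hm (fun x => integral_mem_Icc _ fun y => hg _)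
          (fun x => integral_mem_Icc _ fun y => hg _))
        (integrable_of_mem_Icc _ fun x => integral_mem_Icc _ fun y => hB (x + y)) ?_
      intro x
      have := bregman_integral_le (poissonMeasure ε) hm (fun y => hg (x + 1 + y))
        (fun y => hg (x + y))
      simpa only [add_right_comm] using this
    -- The divergence is averaged under the law of N summands; passing to N + 1 summands costs the
    -- factor exp ε.
    have step2 : ∫ x, entropy (poissonMeasure ε) (fun y => g (x + y)) ∂(poissonMeasure (N * ε)) ≤
        ε * Real.exp ε *
          ∫ x, bregman (g (x + 1)) (g x) ∂(poissonMeasure ((N + 1 : ℕ) * ε)) + K * ε ^ 2 := by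
      have h1 : ∫ x, entropy (poissonMeasure ε) (fun y => g (x + y)) ∂(poissonMeasure (N * ε)) ≤
          ∫ x, (ε * bregman (g (x + 1)) (g x) + K * ε ^ 2) ∂(poissonMeasure (N * ε)) := by
        refine integral_mono ?_ (((integrable_of_mem_Icc _ hB).const_mul _).add
          (integrable_const _)) fun x => ?_
        · refine Integrable.sub
            (integrable_of_mem_Icc _ fun x => integral_mem_Icc _ fun y =>
              mul_log_mem_Icc hm (hg (x + y)))
            (integrable_mul_log _ hm fun x => integral_mem_Icc _ fun y => hg (x + y))
        · exact small ε (fun y => g (x + y)) fun y => hg _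
      refine h1.trans ?_
      rw [integral_add ((integrable_of_mem_Icc _ hB).const_mul _) (integrable_const _),
        integral_const_mul, integral_const]
      have h2 := integral_poissonMeasure_mono (r := N * ε) (s := (N + 1 : ℕ) * ε)
        (by push_cast; gcongr; simp) hB
      have h3 : (((N + 1 : ℕ) * ε : NNReal) : ℝ) - ((N * ε : NNReal) : ℝ) = ε := by
        push_cast; ring
      rw [h3] at h2
      have := mul_le_mul_of_nonneg_left h2 ε.2
      simp only [probReal_univ, one_smul]
      simp only [NNReal.val_eq_coe] at this
      linarith
    rw [hent]
    push_cast at step1 step2 ⊢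
    linarith

/-- The modified logarithmic Sobolev inequality for a Poisson law. -/
theorem entropy_poissonMeasure_le (θ : NNReal) {m C : ℝ} (hm : 0 < m) {g : ℕ → ℝ}
    (hg : ∀ x, g x ∈ Set.Icc m C) :
    entropy (poissonMeasure θ) g ≤
      θ * ∫ x, bregman (g (x + 1)) (g x) ∂(poissonMeasure θ) := by
  set K := C * (Real.log C - Real.log m) + C with hK
  set I := ∫ x, bregman (g (x + 1)) (g x) ∂(poissonMeasure θ) with hI
  -- With N + 1 summands of mean θ/(N + 1), the accumulated error is of order 1/(N + 1) and the
  -- exponential factor tends to 1.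
  have h : ∀ N : ℕ, entropy (poissonMeasure θ) g ≤
      θ * Real.exp (θ * (1 / ((N : ℝ) + 1))) * I + K * θ ^ 2 * (1 / ((N : ℝ) + 1)) := by
    intro N
    have h1 := entropy_poissonMeasure_nat_mul_le (θ / (N + 1)) hm (N + 1) g hg
    have h2 : ((N + 1 : ℕ) : NNReal) * (θ / (N + 1)) = θ := by
      push_cast; field_simp
    rw [h2, ← hI, ← hK] at h1
    refine h1.trans (le_of_eq ?_)
    push_cast
    rw [mul_one_div]
    field_simp
  have lim : Tendsto (fun N : ℕ => θ * Real.exp (θ * (1 / ((N : ℝ) + 1))) * I +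
      K * θ ^ 2 * (1 / ((N : ℝ) + 1))) atTop (𝓝 (θ * Real.exp (θ * 0) * I + K * θ ^ 2 * 0)) := by
    have := tendsto_one_div_add_atTop_nhds_zero_nat (𝕜 := ℝ)
    exact ((((Real.continuous_exp.tendsto _).comp (this.const_mul _)).const_mul _).mul_const _).add
      (this.const_mul _)
  simpa using ge_of_tendsto' lim h

/-! ### Tensorization to independent Poisson variables -/

/-- The law of a vector of independent Poisson variables. -/
noncomputable abbrev poissonPi {n : ℕ} (θ : Fin n → NNReal) : Measure (Fin n → ℕ) :=
  Measure.pi fun i => poissonMeasure (θ i)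

theorem integral_poissonPi_succ {n : ℕ} (θ : Fin (n + 1) → NNReal) (f : (Fin (n + 1) → ℕ) → ℝ) :
    ∫ y, f y ∂(poissonPi θ) =
      ∫ z : ℕ × (Fin n → ℕ), f (Fin.cons z.1 z.2)
        ∂((poissonMeasure (θ 0)).prod (poissonPi fun j => θ j.succ)) := by
  have h := (measurePreserving_piFinSuccAbove (fun i => poissonMeasure (θ i)) 0).symm
  rw [poissonPi, ← h.integral_comp']
  simp only [Fin.succAbove_zero, MeasurableEquiv.piFinSuccAbove_symm_apply]
  refine integral_congr_ae (.of_forall fun z => ?_)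
  simp [Fin.insertNthEquiv]

/-- The modified logarithmic Sobolev inequality for independent Poisson variables. -/
theorem entropy_poissonPi_le {n : ℕ} (θ : Fin n → NNReal) {m C : ℝ} (hm : 0 < m)
    {g : (Fin n → ℕ) → ℝ} (hg : ∀ y, g y ∈ Set.Icc m C) :
    entropy (poissonPi θ) g ≤
      ∑ i, θ i * ∫ y, bregman (g (y + Pi.single i 1)) (g y) ∂(poissonPi θ) := by
  induction n with
  | zero =>
    refine (entropy_le_integral_bregman _ hm hg (hg 0)).trans ?_
    have : ∀ y, bregman (g y) (g 0) = 0 := fun y => by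
      rw [Subsingleton.elim y 0, bregman_self]
    simp only [this]
    simp
  | succ n ih =>
    set μ := poissonMeasure (θ 0) with hμ
    set ν := poissonPi fun j => θ j.succ with hν
    have hg' : ∀ (x : ℕ) (z : Fin n → ℕ), g (Fin.cons x z) ∈ Set.Icc m C := fun x z => hg _
    have hent : entropy (poissonPi θ) g =
        entropy (μ.prod ν) (fun z => g (Fin.cons z.1 z.2)) := by
      unfold entropy
      rw [integral_poissonPi_succ, integral_poissonPi_succ]
    have hB : ∀ (y : Fin (n + 1) → ℕ) i, bregman (g (y + Pi.single i 1)) (g y) ∈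
        Set.Icc 0 (C * (Real.log C - Real.log m) + C) := fun y i => bregman_mem_Icc hm (hg _) (hg _)
    have hfub : ∀ i, ∫ y, bregman (g (y + Pi.single i 1)) (g y) ∂(poissonPi θ) =
        ∫ x, ∫ z, bregman (g (Fin.cons x z + Pi.single i 1)) (g (Fin.cons x z)) ∂ν ∂μ := by
      intro i
      rw [integral_poissonPi_succ]
      exact integral_prod _ (integrable_of_mem_Icc _ fun z => hB _ i)
    have hcons0 : ∀ (x : ℕ) (z : Fin n → ℕ),
        (Fin.cons x z : Fin (n + 1) → ℕ) + Pi.single 0 1 = Fin.cons (x + 1) z := by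
      intro x z
      ext i
      refine Fin.cases ?_ (fun j => ?_) i <;> simp
    have hconsS : ∀ (x : ℕ) (z : Fin n → ℕ) (j : Fin n),
        (Fin.cons x z : Fin (n + 1) → ℕ) + Pi.single j.succ 1 = Fin.cons x (z + Pi.single j 1) := by
      intro x z j
      ext i
      refine Fin.cases ?_ (fun l => ?_) i
      · simp
      · simp [Pi.single_apply]
    rw [hent, entropy_prod μ ν (g := fun x z => g (Fin.cons x z)) hm hg', Fin.sum_univ_succ]
    -- Coordinate 0: the one-dimensional inequality for the partial mean, then Jensen. Other
    -- coordinates: the induction hypothesis with coordinate 0 frozen.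
    refine add_le_add ?_ ?_
    · refine (entropy_poissonMeasure_le (θ 0) hm
        fun x => integral_mem_Icc ν (hg' x)).trans ?_
      rw [hfub]
      refine mul_le_mul_of_nonneg_left (integral_mono
        (integrable_bregman _ hm (fun x => integral_mem_Icc ν (hg' _))
          fun x => integral_mem_Icc ν (hg' _))
        (integrable_of_mem_Icc _ fun x => integral_mem_Icc ν fun z => hB _ 0) fun x => ?_) (θ 0).2
      simp only [hcons0]
      exact bregman_integral_le ν hm (hg' _) (hg' _)
    · have hi : ∀ j : Fin n, Integrable (fun x => (θ j.succ : ℝ) *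
          ∫ z, bregman (g (Fin.cons x z + Pi.single j.succ 1)) (g (Fin.cons x z)) ∂ν) μ :=
        fun j => (integrable_of_mem_Icc _ fun x => integral_mem_Icc ν fun z => hB _ _).const_mul _
      simp only [hfub]
      simp_rw [← integral_const_mul]
      rw [← integral_finsetSum _ fun j _ => ?_]
      · refine integral_mono ?_ (integrable_finsetSum _ fun j _ => ?_) fun x => ?_
        · exact Integrable.sub
            (integrable_of_mem_Icc _ fun x => integral_mem_Icc _ fun z =>
              mul_log_mem_Icc hm (hg' x z))
            (integrable_mul_log _ hm fun x => integral_mem_Icc _ (hg' x))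
        · simpa only [integral_const_mul] using hi j
        · have := ih (fun j => θ j.succ) (hg' x)
          simp only [integral_const_mul]
          simpa only [hconsS] using this
      · simpa only [integral_const_mul] using hi j

/-! ### From entropy to deviations -/

/-- Herbst's argument: an entropy bound for `exp (t F)` gives a bound for its mean. -/
theorem mgf_le_of_entropy_le {α : Type*} [MeasurableSpace α] [DiscreteMeasurableSpace α]
    (μ : Measure α) [IsProbabilityMeasure μ] {F : α → ℝ} {a b D Λ : ℝ}
    (hF : ∀ x, F x ∈ Set.Icc a b) (hΛ : 0 < Λ)
    (hent : ∀ t ∈ Set.Ioc 0 Λ, entropy μ (fun x => Real.exp (t * F x)) ≤ t ^ 2 * D * mgf F μ t) :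
    mgf F μ Λ ≤ Real.exp (Λ * (∫ x, F x ∂μ) + Λ ^ 2 * D) := by
  have hexp : ∀ t, Integrable (fun x => Real.exp (t * F x)) μ := fun t =>
    integrable_of_mem_Icc μ (m := 0) (C := Real.exp (|t| * (|a| + |b|))) fun x => by
      refine ⟨(Real.exp_pos _).le, Real.exp_le_exp.2 ?_⟩
      refine (le_abs_self _).trans ?_
      rw [abs_mul]
      have : |F x| ≤ |a| + |b| := by
        rw [abs_le]
        constructor
        · linarith [(hF x).1, neg_abs_le a, abs_nonneg b]
        · linarith [(hF x).2, le_abs_self b, abs_nonneg a]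
      gcongr
  have hset : integrableExpSet F μ = Set.univ := Set.eq_univ_of_forall hexp
  have hint : ∀ t, t ∈ interior (integrableExpSet F μ) := by simp [hset]
  have hpos : ∀ t, 0 < mgf F μ t := fun t => mgf_pos (hexp t)
  have hder : ∀ t, HasDerivAt (cgf F μ) (deriv (cgf F μ) t) t := fun t =>
    (analyticAt_cgf (hint t)).differentiableAt.hasDerivAt
  have hd : ∀ t ∈ Set.Ioc 0 Λ, t * deriv (cgf F μ) t - cgf F μ t ≤ t ^ 2 * D := by
    intro t ht
    have h := hent t ht
    have e1 : ∫ x, Real.exp (t * F x) * Real.log (Real.exp (t * F x)) ∂μ =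
        t * ∫ x, F x * Real.exp (t * F x) ∂μ := by
      rw [← integral_const_mul]
      congr 1; ext x; rw [Real.log_exp]; ring
    unfold entropy at h
    rw [e1] at h
    rw [deriv_cgf (hint t), cgf]
    have h2 : t * (∫ x, F x * Real.exp (t * F x) ∂μ) - mgf F μ t * Real.log (mgf F μ t) ≤
      t ^ 2 * D * mgf F μ t := h
    have hp := hpos t
    rw [← mul_le_mul_iff_left₀ hp]
    refine le_of_eq_of_le ?_ h2
    field_simp
  -- The derivative of cgf(t)/t is (t cgf'(t) − cgf(t))/t², the entropy divided by t² times the mgf,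
  -- so it is at most D.
  have hanti : AntitoneOn (fun t => cgf F μ t / t - D * t) (Set.Ioc 0 Λ) := by
    have hda : ∀ t ∈ Set.Ioc 0 Λ, HasDerivAt (fun t => cgf F μ t / t - D * t)
        ((deriv (cgf F μ) t * t - cgf F μ t * 1) / t ^ 2 - D * 1) t := fun t ht =>
      ((hder t).div (hasDerivAt_id t) ht.1.ne').sub ((hasDerivAt_id t).const_mul D)
    refine antitoneOn_of_deriv_nonpos (convex_Ioc 0 Λ)
      (fun t ht => (hda t ht).continuousAt.continuousWithinAt)
      (fun t ht => (hda t (interior_subset ht)).differentiableAt.differentiableWithinAt) ?_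
    intro t ht
    have ht' := interior_subset ht
    rw [(hda t ht').deriv, sub_nonpos, div_le_iff₀ (pow_pos ht'.1 2)]
    have := hd t ht'
    linarith
  -- As t ↓ 0, cgf(t)/t tends to cgf'(0), the mean of F; this is the initial condition.
  have hlim : Tendsto (fun t => cgf F μ t / t - D * t) (𝓝[>] 0) (𝓝 ((∫ x, F x ∂μ) - D * 0)) := by
    have h0 := hder 0
    rw [deriv_cgf_zero (hint 0), hasDerivAt_iff_tendsto_slope] at h0
    have h1 : Tendsto (slope (cgf F μ) 0) (𝓝[>] 0) (𝓝 (∫ x, F x ∂μ)) := by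
      simpa using h0.mono_left (nhdsWithin_mono _ fun t (ht : t ∈ Set.Ioi 0) => (ne_of_gt ht : t ≠ 0))
    refine Tendsto.sub (h1.congr fun t => ?_)
      (((continuous_const.mul continuous_id).tendsto 0).mono_left nhdsWithin_le_nhds)
    rw [slope_def_field]
    simp
  have hle : cgf F μ Λ / Λ - D * Λ ≤ (∫ x, F x ∂μ) - D * 0 := by
    refine ge_of_tendsto hlim ?_
    filter_upwards [Ioc_mem_nhdsGT hΛ] with t ht
    exact hanti ht ⟨hΛ, le_rfl⟩ ht.2
  rw [← Real.exp_log (hpos Λ)]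
  refine Real.exp_le_exp.2 ?_
  have : cgf F μ Λ ≤ ((∫ x, F x ∂μ) + D * Λ) * Λ := by
    rw [← div_le_iff₀ hΛ]; linarith
  calc Real.log (mgf F μ Λ) = cgf F μ Λ := rfl
    _ ≤ _ := by linarith

/-- A deviation inequality for functionals of independent Poisson variables. -/
theorem poissonPi_deviation {n : ℕ} (θ : Fin n → NNReal) {F : (Fin n → ℕ) → ℝ} {a c b D u : ℝ}
    (hF : ∀ y, F y ∈ Set.Icc a c) (hb : ∀ y i, F (y + Pi.single i 1) - F y ≤ b)
    (hD : ∀ y, ∑ i, θ i * (F (y + Pi.single i 1) - F y) ^ 2 ≤ D) (hD0 : 0 < D) (hu : 0 < u)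
    (hb0 : 0 ≤ b) (hbD : b ^ 2 * u ≤ D) :
    (poissonPi θ).real {y | (∫ y, F y ∂(poissonPi θ)) + 2 * √(u * D) ≤ F y} ≤ Real.exp (-u) := by
  -- Minimizer of −2Λ√(uD) + Λ²D, with value −u. The hypothesis `hbD` amounts to Λb ≤ 1.
  set Λ := √(u / D) with hΛdef
  have hΛ : 0 < Λ := Real.sqrt_pos.2 (by positivity)
  have hΛ2 : Λ ^ 2 = u / D := Real.sq_sqrt (by positivity)
  have hΛb : Λ * b ≤ 1 := by
    have : (Λ * b) ^ 2 ≤ 1 := by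
      rw [mul_pow, hΛ2, div_mul_eq_mul_div, div_le_one hD0]; linarith
    nlinarith [mul_nonneg hΛ.le hb0]
  have hexpI : ∀ t, 0 ≤ t → ∀ y, Real.exp (t * F y) ∈
      Set.Icc (Real.exp (t * a)) (Real.exp (t * c)) := fun t ht y =>
    ⟨Real.exp_le_exp.2 (mul_le_mul_of_nonneg_left (hF y).1 ht),
      Real.exp_le_exp.2 (mul_le_mul_of_nonneg_left (hF y).2 ht)⟩
  have hmgf := mgf_le_of_entropy_le (poissonPi θ) (D := D) hF hΛ (fun t ht => by
    have hI := hexpI t ht.1.le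
    refine (entropy_poissonPi_le θ (Real.exp_pos _) hI).trans ?_
    have hii : ∀ i, Integrable (fun y => (θ i : ℝ) *
        bregman (Real.exp (t * F (y + Pi.single i 1))) (Real.exp (t * F y))) (poissonPi θ) :=
      fun i => (integrable_bregman _ (Real.exp_pos _) (fun y => hI _) hI).const_mul _
    simp_rw [← integral_const_mul]
    rw [← integral_finsetSum _ fun i _ => hii i, mgf, ← integral_const_mul]
    refine integral_mono (integrable_finsetSum _ fun i _ => hii i)
      ((integrable_of_mem_Icc _ hI).const_mul _) fun y => ?_
    have hterm : ∀ i, (θ i : ℝ) *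
        bregman (Real.exp (t * F (y + Pi.single i 1))) (Real.exp (t * F y)) ≤
        (t ^ 2 * Real.exp (t * F y)) * (θ i * (F (y + Pi.single i 1) - F y) ^ 2) := by
      intro i
      set s := t * F (y + Pi.single i 1) - t * F y with hs
      have hs1 : s ≤ 1 := by
        have h1 : t * (F (y + Pi.single i 1) - F y) ≤ t * b :=
          mul_le_mul_of_nonneg_left (hb y i) ht.1.le
        have h2 : t * b ≤ Λ * b := mul_le_mul_of_nonneg_right ht.2 hb0
        linarith
      -- Multiply exp s ≥ 1 + s by 1 − s ≥ 0. Only an upper bound on s is needed, so increments of F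
      -- are controlled from above only.
      have h3 : s * Real.exp s - Real.exp s + 1 ≤ s ^ 2 := by
        nlinarith [Real.add_one_le_exp s]
      rw [bregman_exp, ← hs]
      have h4 := mul_le_mul_of_nonneg_left h3
        (mul_nonneg (θ i).2 (Real.exp_pos (t * F y)).le)
      have h5 : s ^ 2 = t ^ 2 * (F (y + Pi.single i 1) - F y) ^ 2 := by rw [hs]; ring
      rw [h5] at h4
      simp only [NNReal.val_eq_coe] at h4
      linarith
    refine (Finset.sum_le_sum fun i _ => hterm i).trans ?_
    rw [← Finset.mul_sum]
    have := mul_le_mul_of_nonneg_left (hD y)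
      (mul_nonneg (sq_nonneg t) (Real.exp_pos (t * F y)).le)
    linarith)
  refine (measure_ge_le_exp_mul_mgf _ hΛ.le (integrable_of_mem_Icc _ (hexpI Λ hΛ.le))).trans ?_
  refine (mul_le_mul_of_nonneg_left hmgf (Real.exp_pos _).le).trans ?_
  rw [← Real.exp_add]
  refine Real.exp_le_exp.2 (le_of_eq ?_)
  have h1 : Λ * √(u * D) = u := by
    rw [hΛdef, ← Real.sqrt_mul (by positivity)]
    have : u / D * (u * D) = u ^ 2 := by field_simp
    rw [this, Real.sqrt_sq hu.le]
  have h2 : Λ ^ 2 * D = u := by rw [hΛ2]; field_simp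
  linarith

/-! ### Moments of the Poisson law -/

theorem poissonMeasure_weight_succ (r : NNReal) (k : ℕ) :
    Real.exp (-r) * (r : ℝ) ^ (k + 1) / ((k + 1).factorial : ℝ) * ((k + 1 : ℕ) : ℝ) =
      r * (Real.exp (-r) * (r : ℝ) ^ k / (k.factorial : ℝ)) := by
  rw [Nat.factorial_succ]
  push_cast
  field_simp
  ring

theorem integrable_mul_poissonMeasure {r : NNReal} {f : ℕ → ℝ}
    (hf : Integrable (fun k => f (k + 1)) (poissonMeasure r)) :
    Integrable (fun k : ℕ => (k : ℝ) * f k) (poissonMeasure r) := by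
  rw [integrable_poissonMeasure_iff] at hf ⊢
  rw [← summable_nat_add_iff 1]
  refine (hf.mul_left (r : ℝ)).congr fun k => ?_
  rw [norm_mul, Real.norm_natCast, ← mul_assoc, ← mul_assoc, poissonMeasure_weight_succ]

/-- The Chen–Stein identity, a shift of index in the series; f = 1 gives the mean and f(k) = k the
second moment. -/
theorem integral_mul_poissonMeasure {r : NNReal} {f : ℕ → ℝ}
    (hf : Integrable (fun k => f (k + 1)) (poissonMeasure r)) :
    ∫ k : ℕ, (k : ℝ) * f k ∂(poissonMeasure r) = r * ∫ k, f (k + 1) ∂(poissonMeasure r) := by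
  have h1 := hasSum_integral_poissonMeasure (integrable_mul_poissonMeasure hf)
  rw [← hasSum_nat_add_iff' 1] at h1
  have h2 := (hasSum_integral_poissonMeasure hf).mul_left (r : ℝ)
  have e : (fun k : ℕ => (Real.exp (-r) * (r : ℝ) ^ (k + 1) / ((k + 1).factorial : ℝ)) •
      (((k + 1 : ℕ) : ℝ) * f (k + 1))) =
      fun k : ℕ => (r : ℝ) * ((Real.exp (-r) * (r : ℝ) ^ k / (k.factorial : ℝ)) • f (k + 1)) := by
    ext k
    rw [smul_eq_mul, smul_eq_mul, ← mul_assoc, ← mul_assoc, poissonMeasure_weight_succ]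
  rw [e] at h1
  simpa using h1.unique h2

theorem integrable_cast_poissonMeasure (r : NNReal) :
    Integrable (fun k : ℕ => (k : ℝ)) (poissonMeasure r) := by
  simpa using integrable_mul_poissonMeasure (r := r) (f := fun _ => 1) (integrable_const _)

theorem integral_cast_poissonMeasure (r : NNReal) :
    ∫ k : ℕ, (k : ℝ) ∂(poissonMeasure r) = r := by
  simpa using integral_mul_poissonMeasure (r := r) (f := fun _ => 1) (integrable_const _)

theorem integrable_succ_poissonMeasure (r : NNReal) :
    Integrable (fun k : ℕ => ((k + 1 : ℕ) : ℝ)) (poissonMeasure r) := by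
  simpa using (integrable_cast_poissonMeasure r).add (integrable_const 1)

theorem memLp_cast_poissonMeasure (r : NNReal) :
    MemLp (fun k : ℕ => (k : ℝ)) 2 (poissonMeasure r) := by
  rw [memLp_two_iff_integrable_sq .of_discrete]
  simpa only [sq] using
    integrable_mul_poissonMeasure (f := fun k => (k : ℝ)) (integrable_succ_poissonMeasure r)

theorem variance_poissonMeasure (r : NNReal) :
    Var[fun k : ℕ => (k : ℝ); poissonMeasure r] = r := by
  rw [variance_eq_sub (memLp_cast_poissonMeasure r)]
  have h := integral_mul_poissonMeasure (f := fun k => (k : ℝ)) (integrable_succ_poissonMeasure r)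
  have h2 : ∫ k : ℕ, ((k + 1 : ℕ) : ℝ) ∂(poissonMeasure r) = r + 1 := by
    push_cast
    rw [integral_add (integrable_cast_poissonMeasure r) (integrable_const _),
      integral_cast_poissonMeasure]
    simp
  rw [h2] at h
  simp only [Pi.pow_apply, sq, integral_cast_poissonMeasure, h]
  ring

theorem mgf_poissonMeasure (r : NNReal) (t : ℝ) :
    ∫ k : ℕ, Real.exp (t * k) ∂(poissonMeasure r) = Real.exp (r * (Real.exp t - 1)) := by
  have h := (NormedSpace.expSeries_div_hasSum_exp (𝔸 := ℝ) (r * Real.exp t)).mul_left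
    (Real.exp (-r))
  rw [← Real.exp_eq_exp_ℝ, ← Real.exp_add] at h
  rw [integral_poissonMeasure]
  have e : (r : ℝ) * (Real.exp t - 1) = -r + r * Real.exp t := by ring
  rw [e, ← h.tsum_eq]
  congr 1
  ext k
  rw [mul_comm t, Real.exp_nat_mul, mul_pow, smul_eq_mul]
  ring

/-! ### Linear forms in independent Poisson variables -/

section Pi

variable {n : ℕ} (θ : Fin n → NNReal)

theorem memLp_linear_poissonPi (w : Fin n → ℝ) :
    MemLp (fun y : Fin n → ℕ => ∑ i, w i * ((y i : ℝ) - θ i)) 2 (poissonPi θ) := by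
  refine memLp_finsetSum _ fun i _ => ?_
  have h : MemLp (fun k : ℕ => w i * ((k : ℝ) - θ i)) 2 (poissonMeasure (θ i)) :=
    ((memLp_cast_poissonMeasure (θ i)).sub (memLp_const _)).const_mul _
  exact h.comp_measurePreserving (measurePreserving_eval _ i)

theorem integral_sq_linear_poissonPi (w : Fin n → ℝ) :
    ∫ y, (∑ i, w i * ((y i : ℝ) - θ i)) ^ 2 ∂(poissonPi θ) = ∑ i, w i ^ 2 * θ i := by
  have hL : ∀ i, MemLp (fun k : ℕ => w i * ((k : ℝ) - θ i)) 2 (poissonMeasure (θ i)) := fun i =>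
    ((memLp_cast_poissonMeasure (θ i)).sub (memLp_const _)).const_mul _
  have hv := variance_sum_pi hL
  have hs : (∑ i, fun y : Fin n → ℕ => w i * ((y i : ℝ) - θ i)) =
      fun y => ∑ i, w i * ((y i : ℝ) - θ i) := by ext y; simp
  have h0 : ∫ y, (∑ i, w i * ((y i : ℝ) - θ i)) ∂(poissonPi θ) = 0 := by
    rw [integral_finsetSum]
    · refine Finset.sum_eq_zero fun i _ => ?_
      rw [integral_comp_eval (μ := fun i => poissonMeasure (θ i))
        (f := fun k : ℕ => w i * ((k : ℝ) - θ i)) .of_discrete, integral_const_mul,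
        integral_sub (integrable_cast_poissonMeasure _) (integrable_const _),
        integral_cast_poissonMeasure]
      simp
    · exact fun i _ => integrable_comp_eval (μ := fun i => poissonMeasure (θ i))
        (f := fun k : ℕ => w i * ((k : ℝ) - θ i)) ((hL i).integrable (by norm_num))
  rw [hs, variance_eq_sub (memLp_linear_poissonPi θ w), h0] at hv
  have hvar : ∀ i, Var[fun k : ℕ => w i * ((k : ℝ) - θ i); poissonMeasure (θ i)] =
      w i ^ 2 * θ i := by
    intro i
    rw [variance_const_mul, variance_sub_const .of_discrete, variance_poissonMeasure]
  simpa [hvar] using hv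

/-- Lower tail of a nonnegative linear form in independent Poisson variables. -/
theorem poissonPi_lower_tail {w : Fin n → ℝ} {m u : ℝ} (hw0 : ∀ i, 0 ≤ w i) (hwm : ∀ i, w i ≤ m)
    (hm : 0 < m) (hu : 0 < u) (hV : 0 < ∑ i, w i * θ i) :
    (poissonPi θ).real {y | ∑ i, w i * (y i : ℝ) ≤
      (∑ i, w i * θ i) - √(2 * u * m * ∑ i, w i * θ i)} ≤ Real.exp (-u) := by
  set V := ∑ i, w i * (θ i : ℝ) with hVdef
  -- Minimizer of the Chernoff exponent −t√(2umV) + t²mV/2, with value −u.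
  set t := √(2 * u / (m * V)) with ht
  have ht0 : 0 ≤ t := Real.sqrt_nonneg _
  have ht2 : t ^ 2 * (m * V) = 2 * u := by
    rw [ht, Real.sq_sqrt (by positivity)]; field_simp
  have htV : t * √(2 * u * m * V) = 2 * u := by
    rw [ht, ← Real.sqrt_mul (by positivity)]
    have : 2 * u / (m * V) * (2 * u * m * V) = (2 * u) ^ 2 := by field_simp
    rw [this, Real.sqrt_sq (by positivity)]
  have hint : Integrable (fun y : Fin n → ℕ => Real.exp (-t * ∑ i, w i * (y i : ℝ)))
      (poissonPi θ) := by
    refine integrable_of_mem_Icc _ (m := 0) (C := 1) fun y => ⟨(Real.exp_pos _).le, ?_⟩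
    rw [Real.exp_le_one_iff]
    have : 0 ≤ ∑ i, w i * (y i : ℝ) :=
      Finset.sum_nonneg fun i _ => mul_nonneg (hw0 i) (Nat.cast_nonneg _)
    nlinarith
  -- Follows from exp x ≥ 1 + x + x²/2, since (1 − x + x²/2)(1 + x + x²/2) = 1 + x⁴/4 ≥ 1.
  have hexp : ∀ x : ℝ, 0 ≤ x → Real.exp (-x) ≤ 1 - x + x ^ 2 / 2 := by
    intro x hx
    rw [Real.exp_neg]
    refine inv_le_of_inv_le₀ (by nlinarith [sq_nonneg (x - 1)]) ?_
    refine le_trans ?_ (Real.quadratic_le_exp_of_nonneg hx)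
    rw [inv_le_iff_one_le_mul₀ (by nlinarith [sq_nonneg (x - 1)])]
    nlinarith [sq_nonneg (x ^ 2)]
  have hmgf : mgf (fun y : Fin n → ℕ => ∑ i, w i * (y i : ℝ)) (poissonPi θ) (-t) ≤
      Real.exp (-t * V + t ^ 2 * (m * V) / 2) := by
    have h1 : mgf (fun y : Fin n → ℕ => ∑ i, w i * (y i : ℝ)) (poissonPi θ) (-t) =
        ∏ i, Real.exp (θ i * (Real.exp (-t * w i) - 1)) := by
      simp_rw [← mgf_poissonMeasure]
      rw [← integral_fintype_prod_eq_prod (fun i (k : ℕ) => Real.exp (-t * w i * k)), mgf]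
      congr 1
      ext y
      simp only [← Real.exp_sum, Finset.mul_sum, mul_assoc]
    rw [h1, ← Real.exp_sum]
    refine Real.exp_le_exp.2 ?_
    have h2 : ∀ i, (θ i : ℝ) * (Real.exp (-t * w i) - 1) ≤
        -t * (w i * θ i) + t ^ 2 * m / 2 * (w i * θ i) := by
      intro i
      have e1 := hexp (t * w i) (mul_nonneg ht0 (hw0 i))
      have e2 : (t * w i) ^ 2 ≤ t ^ 2 * m * w i := by
        have := mul_le_mul_of_nonneg_left (hwm i) (mul_nonneg (sq_nonneg t) (hw0 i))
        nlinarith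
      have e3 : Real.exp (-t * w i) - 1 ≤ -t * w i + t ^ 2 * m / 2 * w i := by
        rw [neg_mul]; linarith
      have e4 := mul_le_mul_of_nonneg_left e3 (θ i).2
      simp only [NNReal.val_eq_coe] at e4
      linarith
    refine (Finset.sum_le_sum fun i _ => h2 i).trans (le_of_eq ?_)
    rw [Finset.sum_add_distrib, ← Finset.mul_sum, ← Finset.mul_sum]
    ring
  refine (measure_le_le_exp_mul_mgf _ (neg_nonpos.2 ht0) hint).trans ?_
  refine (mul_le_mul_of_nonneg_left hmgf (Real.exp_pos _).le).trans ?_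
  rw [← Real.exp_add]
  refine Real.exp_le_exp.2 (le_of_eq ?_)
  rw [neg_neg, mul_sub, htV, ht2]
  ring

/-- Removes the unknown V from under the root. With t = √(2q), the hypothesis forces √V ≤ √v + t;
substituting back gives V ≤ v + t√v + t², and t² = 2q ≤ 3q. -/
theorem le_add_sqrt_of_sub_sqrt_lt {V v q : ℝ} (hV : 0 ≤ V) (hv : 0 ≤ v) (hq : 0 ≤ q)
    (h : V - √(2 * q * V) < v) : V ≤ v + √(2 * q * v) + 3 * q := by
  have hs : ∀ x, √(2 * q * x) = √(2 * q) * √x := fun x => Real.sqrt_mul (by positivity) _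
  rw [hs] at h ⊢
  have e1 := Real.sq_sqrt hV
  have e2 := Real.sq_sqrt hv
  have e3 := Real.sq_sqrt (show 0 ≤ 2 * q by positivity)
  set x := √V
  set y := √v
  set t := √(2 * q)
  have hx : 0 ≤ x := Real.sqrt_nonneg _
  have hy : 0 ≤ y := Real.sqrt_nonneg _
  have ht : 0 ≤ t := Real.sqrt_nonneg _
  have hxy : x ≤ y + t := by
    by_contra! hc
    nlinarith [mul_nonneg hx (by linarith : 0 ≤ x - t - y), mul_nonneg hy (by linarith : 0 ≤ x - y)]
  nlinarith [mul_le_mul_of_nonneg_left hxy ht]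

end Pi

/-! ### Deviation of the Euclidean norm -/

section Norm

variable {E : Type*} [NormedAddCommGroup E] [InnerProductSpace ℝ E]

/-- Write x, y for the old and new truncated norms: |y − x| x ≤ |y² − x²|, truncation does not
enlarge the difference of squares, and (2p + q)² ≤ 8p² + 2q². -/
theorem sq_max_norm_add_sub_le (s a : E) (T : ℝ) :
    (max ‖s + a‖ T - max ‖s‖ T) ^ 2 * (max ‖s‖ T) ^ 2 ≤
      8 * inner ℝ s a ^ 2 + 2 * (‖a‖ ^ 2) ^ 2 := by
  have h1 : ‖s + a‖ ^ 2 - ‖s‖ ^ 2 = 2 * inner ℝ s a + ‖a‖ ^ 2 := by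
    rw [norm_add_sq_real]; ring
  have hx : 0 ≤ max ‖s‖ T := (norm_nonneg s).trans (le_max_left _ _)
  have hy : 0 ≤ max ‖s + a‖ T := (norm_nonneg _).trans (le_max_left _ _)
  set d := 2 * inner ℝ s a + ‖a‖ ^ 2 with hd
  have key : |max ‖s + a‖ T - max ‖s‖ T| * (max ‖s‖ T) ≤ |d| := by
    have hx' : max ‖s‖ T ≤ max ‖s + a‖ T + max ‖s‖ T := by linarith
    refine (mul_le_mul_of_nonneg_left hx' (abs_nonneg _)).trans ?_
    rw [← abs_of_nonneg (add_nonneg hy hx), ← abs_mul, ← h1]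
    have ns := norm_nonneg s
    have na := norm_nonneg (s + a)
    rcases le_total ‖s + a‖ T with h | h <;> rcases le_total ‖s‖ T with h' | h'
    · simp [h, h']
    · rw [max_eq_right h, max_eq_left h', abs_le]
      constructor <;> cases abs_cases (‖s + a‖ ^ 2 - ‖s‖ ^ 2) <;> nlinarith
    · rw [max_eq_left h, max_eq_right h', abs_le]
      constructor <;> cases abs_cases (‖s + a‖ ^ 2 - ‖s‖ ^ 2) <;> nlinarith
    · rw [max_eq_left h, max_eq_left h']
      exact le_of_eq (by congr 1; ring)
  have h2 : (|max ‖s + a‖ T - max ‖s‖ T| * (max ‖s‖ T)) ^ 2 ≤ |d| ^ 2 :=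
    pow_le_pow_left₀ (mul_nonneg (abs_nonneg _) hx) key 2
  rw [mul_pow, sq_abs, sq_abs] at h2
  refine h2.trans ?_
  nlinarith [sq_nonneg (2 * inner ℝ s a - ‖a‖ ^ 2)]

end Norm

theorem l2norm_sq {ι : Type*} [Fintype ι] (v : ι → ℝ) : l2norm v ^ 2 = ∑ j, v j ^ 2 := by
  simp [l2norm, EuclideanSpace.norm_sq_eq]

section Group

variable {n : ℕ} {ι : Type*} [Fintype ι]

theorem transpose_mulVec_sq_integral (B : Matrix (Fin n) ι ℝ) (θ : Fin n → NNReal) :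
    Integrable (fun y : Fin n → ℕ => l2norm (Bᵀ *ᵥ fun i => (y i : ℝ) - θ i) ^ 2) (poissonPi θ) ∧
    ∫ y, l2norm (Bᵀ *ᵥ fun i => (y i : ℝ) - θ i) ^ 2 ∂(poissonPi θ) =
      ∑ i, θ i * ∑ j, B i j ^ 2 := by
  have e : (fun y : Fin n → ℕ => l2norm (Bᵀ *ᵥ fun i => (y i : ℝ) - θ i) ^ 2) =
      fun y => ∑ j, (∑ i, B i j * ((y i : ℝ) - θ i)) ^ 2 := by
    ext y
    rw [l2norm_sq]
    rfl
  have hi : ∀ j, Integrable (fun y : Fin n → ℕ => (∑ i, B i j * ((y i : ℝ) - θ i)) ^ 2)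
      (poissonPi θ) := fun j => (memLp_linear_poissonPi θ fun i => B i j).integrable_sq
  rw [e]
  refine ⟨integrable_finsetSum _ fun j _ => hi j, ?_⟩
  rw [integral_finsetSum _ fun j _ => hi j]
  simp_rw [integral_sq_linear_poissonPi θ fun i => B i _, Finset.mul_sum]
  rw [Finset.sum_comm]
  simp_rw [mul_comm]

theorem integral_l2norm_le (B : Matrix (Fin n) ι ℝ) (θ : Fin n → NNReal) :
    Integrable (fun y : Fin n → ℕ => l2norm (Bᵀ *ᵥ fun i => (y i : ℝ) - θ i)) (poissonPi θ) ∧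
    ∫ y, l2norm (Bᵀ *ᵥ fun i => (y i : ℝ) - θ i) ∂(poissonPi θ) ≤
      √(∑ i, θ i * ∑ j, B i j ^ 2) := by
  obtain ⟨h1, h2⟩ := transpose_mulVec_sq_integral B θ
  have hL : MemLp (fun y : Fin n → ℕ => l2norm (Bᵀ *ᵥ fun i => (y i : ℝ) - θ i)) 2
      (poissonPi θ) := (memLp_two_iff_integrable_sq .of_discrete).2 h1
  refine ⟨hL.integrable (by norm_num), Real.le_sqrt_of_sq_le ?_⟩
  have hv := variance_nonneg (fun y : Fin n → ℕ => l2norm (Bᵀ *ᵥ fun i => (y i : ℝ) - θ i))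
    (poissonPi θ)
  rw [variance_eq_sub hL] at hv
  simp only [Pi.pow_apply] at hv
  linarith

/-- Deviation of the Euclidean norm of a centred linear image of a Poisson vector. -/
theorem l2norm_deviation (B : Matrix (Fin n) ι ℝ) (θ : Fin n → NNReal) {M c b u : ℝ}
    (hM : ∀ i, (θ i : ℝ) ≤ M) (hM0 : 0 ≤ M)
    (hc : ∀ v, l2norm (B *ᵥ (Bᵀ *ᵥ v)) ≤ c * l2norm (Bᵀ *ᵥ v))
    (hb : ∀ i, ∑ j, B i j ^ 2 ≤ b ^ 2) (hb0 : 0 < b) (hu : 0 < u)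
    (hV : 0 < ∑ i, θ i * ∑ j, B i j ^ 2) :
    (poissonPi θ).real {y | (1 + 1 / (2 * √(2 * u))) * √(∑ i, θ i * ∑ j, B i j ^ 2) +
        2 * √(u * (8 * M * c ^ 2 + 16 * b ^ 2 * u)) ≤
      l2norm (Bᵀ *ᵥ fun i => (y i : ℝ) - θ i)} ≤ Real.exp (-u) := by
  obtain ⟨hNi, hN⟩ := integral_l2norm_le B θ
  set V := ∑ i, θ i * ∑ j, B i j ^ 2 with hVdef
  set D := 8 * M * c ^ 2 + 16 * b ^ 2 * u with hDdef
  -- Truncation at T adds at most T to the mean, whence the factor 1 + 1/(2√(2u)). In return V =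
  -- 8uT², which turns the quadratic term 2b²V/N², N ≥ T, into at most 16b²u.
  set T := √V / (2 * √(2 * u)) with hTdef
  set R := (1 + 1 / (2 * √(2 * u))) * √V + 2 * √(u * D) with hRdef
  have hR : R = √V + T + 2 * √(u * D) := by rw [hRdef, hTdef]; ring
  have hT2 : T ^ 2 * (8 * u) = V := by
    rw [hTdef, div_pow, mul_pow, Real.sq_sqrt hV.le, Real.sq_sqrt (by positivity)]
    field_simp
    norm_num
  have hT0 : 0 < T := by positivity
  have hR0 : 0 ≤ R := by rw [hR]; positivity
  have hD0 : 0 < D := by positivity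
  let S : (Fin n → ℕ) → EuclideanSpace ℝ ι := fun y =>
    WithLp.toLp 2 (Bᵀ *ᵥ fun i => (y i : ℝ) - θ i)
  let a : Fin n → EuclideanSpace ℝ ι := fun i => WithLp.toLp 2 (B i)
  have ha : ∀ i, ‖a i‖ ^ 2 = ∑ j, B i j ^ 2 := fun i => l2norm_sq (B i)
  have hSa : ∀ y i, S (y + Pi.single i 1) = S y + a i := by
    intro y i
    ext j
    simp only [S, a, PiLp.add_apply, Matrix.mulVec, dotProduct, Matrix.transpose_apply]
    have : ∀ l, B l j * ((((y + Pi.single i 1 : Fin n → ℕ) l : ℕ) : ℝ) - θ l) =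
        B l j * ((y l : ℝ) - θ l) + if l = i then B l j else 0 := by
      intro l
      by_cases h : l = i
      · subst h; simp; ring
      · simp [h]
    simp only [this, Finset.sum_add_distrib]
    simp
  have hinner : ∀ y i, inner ℝ (S y) (a i) = (B *ᵥ (Bᵀ *ᵥ fun l => (y l : ℝ) - θ l)) i := by
    intro y i
    simp [S, a, PiLp.inner_apply, Matrix.mulVec, dotProduct]
  -- The cap at R only supplies the boundedness required by `poissonPi_deviation`: on the event
  -- considered, F equals R.
  let F : (Fin n → ℕ) → ℝ := fun y => min (max ‖S y‖ T) R
  have hF : ∀ y, F y ∈ Set.Icc 0 R := fun y =>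
    ⟨le_min (hT0.le.trans (le_max_right _ _)) hR0, min_le_right _ _⟩
  have hdiff : ∀ y i, |F (y + Pi.single i 1) - F y| ≤ |max ‖S y + a i‖ T - max ‖S y‖ T| := by
    intro y i
    simp only [F, hSa]
    exact abs_inf_sub_inf_le_abs _ _ _
  have hbF : ∀ y i, F (y + Pi.single i 1) - F y ≤ b := by
    intro y i
    refine (le_abs_self _).trans ((hdiff y i).trans ?_)
    refine (abs_max_sub_max_le_abs _ _ _).trans ((abs_norm_sub_norm_le _ _).trans ?_)
    rw [add_sub_cancel_left]
    exact abs_le_of_sq_le_sq' ((ha i).trans_le (hb i)) hb0.le |>.2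
  have hDF : ∀ y, ∑ i, θ i * (F (y + Pi.single i 1) - F y) ^ 2 ≤ D := by
    intro y
    set N := max ‖S y‖ T with hNdef
    have hNT : T ≤ N := le_max_right _ _
    have hNS : ‖S y‖ ≤ N := le_max_left _ _
    have hN0 : 0 < N := hT0.trans_le hNT
    have h1 : ∀ i, (θ i : ℝ) * (F (y + Pi.single i 1) - F y) ^ 2 * N ^ 2 ≤
        8 * M * ((B *ᵥ (Bᵀ *ᵥ fun l => (y l : ℝ) - θ l)) i) ^ 2 +
          2 * b ^ 2 * (θ i * ∑ j, B i j ^ 2) := by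
      intro i
      have e1 := sq_max_norm_add_sub_le (S y) (a i) T
      have e2 : (F (y + Pi.single i 1) - F y) ^ 2 ≤ (max ‖S y + a i‖ T - max ‖S y‖ T) ^ 2 :=
        sq_le_sq.2 (hdiff y i)
      rw [hinner, ha] at e1
      have e3 := (mul_le_mul_of_nonneg_right e2 (sq_nonneg N)).trans e1
      have hq : 0 ≤ ∑ j, B i j ^ 2 := Finset.sum_nonneg fun j _ => sq_nonneg _
      have e4 : (∑ j, B i j ^ 2) ^ 2 ≤ b ^ 2 * ∑ j, B i j ^ 2 := by
        rw [sq]; exact mul_le_mul_of_nonneg_right (hb i) hq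
      have hθ : (0 : ℝ) ≤ θ i := (θ i).2
      have e5 := mul_le_mul_of_nonneg_left (e3.trans (add_le_add le_rfl
        (mul_le_mul_of_nonneg_left e4 zero_le_two))) hθ
      have e6 := mul_le_mul_of_nonneg_right (hM i)
        (sq_nonneg ((B *ᵥ (Bᵀ *ᵥ fun l => (y l : ℝ) - θ l)) i))
      linarith
    -- Summed over i, the inner products form ‖BBᵀv‖² ≤ c²N² and the squared row norms weighted by θ
    -- form V ≤ 8uN².
    have h2 : (∑ i, θ i * (F (y + Pi.single i 1) - F y) ^ 2) * N ^ 2 ≤ D * N ^ 2 := by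
      rw [Finset.sum_mul]
      refine (Finset.sum_le_sum fun i _ => h1 i).trans ?_
      rw [Finset.sum_add_distrib, ← Finset.mul_sum, ← Finset.mul_sum, ← hVdef, ← l2norm_sq]
      have h3 : l2norm (B *ᵥ (Bᵀ *ᵥ fun l => (y l : ℝ) - θ l)) ^ 2 ≤ c ^ 2 * N ^ 2 := by
        have h := pow_le_pow_left₀ (norm_nonneg _) (hc fun l => (y l : ℝ) - θ l) 2
        rw [mul_pow] at h
        refine h.trans (mul_le_mul_of_nonneg_left ?_ (sq_nonneg c))
        exact pow_le_pow_left₀ (norm_nonneg _) hNS 2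
      have h4 : V ≤ 8 * u * N ^ 2 := by
        rw [← hT2, mul_comm]
        exact mul_le_mul_of_nonneg_left (pow_le_pow_left₀ hT0.le hNT 2) (by positivity)
      have h5 := mul_le_mul_of_nonneg_left h3 (by positivity : 0 ≤ 8 * M)
      have h6 := mul_le_mul_of_nonneg_left h4 (by positivity : 0 ≤ 2 * b ^ 2)
      rw [hDdef]
      linarith
    exact le_of_mul_le_mul_right h2 (by positivity)
  have hbD : b ^ 2 * u ≤ D := by
    have : 0 ≤ 8 * M * c ^ 2 := by positivity
    have : 0 < b ^ 2 * u := by positivity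
    linarith
  refine le_trans (measureReal_mono ?_)
    (poissonPi_deviation θ hF hbF hDF hD0 hu hb0.le hbD)
  intro y hy
  have hmean : ∫ y, F y ∂(poissonPi θ) ≤ √V + T := by
    have : ∫ y, F y ∂(poissonPi θ) ≤ ∫ y, (‖S y‖ + T) ∂(poissonPi θ) := by
      refine integral_mono (integrable_of_mem_Icc _ hF) (hNi.add (integrable_const T)) fun y => ?_
      exact (min_le_left _ _).trans
        (max_le (le_add_of_nonneg_right hT0.le) (le_add_of_nonneg_left (norm_nonneg _)))
    have hNi' : Integrable (fun y => ‖S y‖) (poissonPi θ) := hNi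
    rw [integral_add hNi' (integrable_const T)] at this
    simp only [integral_const, probReal_univ, one_smul] at this
    exact this.trans (add_le_add hN le_rfl)
  have hFy : F y = R := min_eq_right (le_trans hy (le_max_left _ _))
  change _ ≤ F y
  rw [hFy, hR]
  linarith

end Group

/-! ### The data-driven weight -/

section Design

variable {n p : ℕ} (A : Matrix (Fin n) (Fin p) ℝ) (G : Finset (Fin p))

theorem cConst_mul_le (v : Fin n → ℝ) :
    l2norm (groupMatrix A G *ᵥ ((groupMatrix A G)ᵀ *ᵥ v)) ≤
      cConst A G * l2norm ((groupMatrix A G)ᵀ *ᵥ v) := by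
  set B := groupMatrix A G with hB
  by_cases hv : Bᵀ *ᵥ v = 0
  · simp [hv, l2norm]
  have hpos : 0 < l2norm (Bᵀ *ᵥ v) := by
    rw [l2norm, norm_pos_iff]
    simpa using hv
  rw [← div_le_iff₀ hpos, Matrix.mulVec_mulVec]
  -- The set of quotients must be shown bounded, as a real `sSup` defaults to 0 otherwise; the
  -- operator norm of B is a bound.
  refine le_csSup ?_ ⟨v, hv, rfl⟩
  let L : EuclideanSpace ℝ G →L[ℝ] EuclideanSpace ℝ (Fin n) :=
    LinearMap.toContinuousLinearMap (Matrix.toLpLin 2 2 B)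
  refine ⟨‖L‖, ?_⟩
  rintro _ ⟨w, hw, rfl⟩
  have hwpos : 0 < l2norm (Bᵀ *ᵥ w) := by
    rw [l2norm, norm_pos_iff]
    simpa using hw
  simp only
  rw [div_le_iff₀ hwpos, ← Matrix.mulVec_mulVec]
  exact L.le_opNorm (WithLp.toLp 2 (Bᵀ *ᵥ w))

theorem sum_sq_le_bConst_sq (i : Fin n) : ∑ j : G, groupMatrix A G i j ^ 2 ≤ bConst A G ^ 2 := by
  have h : √(∑ j ∈ G, A i j ^ 2) ≤ bConst A G :=
    le_ciSup (f := fun i : Fin n => √(∑ j ∈ G, A i j ^ 2)) (Set.finite_range _).bddAbove i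
  have h0 : 0 ≤ ∑ j ∈ G, A i j ^ 2 := Finset.sum_nonneg fun j _ => sq_nonneg _
  have e : ∑ j : G, groupMatrix A G i j ^ 2 = ∑ j ∈ G, A i j ^ 2 :=
    Finset.sum_coe_sort G fun j => A i j ^ 2
  rw [e, ← Real.sq_sqrt h0]
  exact pow_le_pow_left₀ (Real.sqrt_nonneg _) h 2

theorem varHat_nonneg (y : Fin n → ℕ) (j : Fin p) : 0 ≤ varHat A y j :=
  Finset.sum_nonneg fun _ _ => mul_nonneg (sq_nonneg _) (Nat.cast_nonneg _)

/-- The inflated variance estimate falls below the variance with small probability. -/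
theorem varTilde_lt_variance (θ : Fin n → NNReal) {γ : ℝ} (j : Fin p)
    (hu : 0 < γ * Real.log p + Real.log G.card) :
    (poissonPi θ).real {y | varTilde A G γ y j < ∑ i, A i j ^ 2 * θ i} ≤
      Real.exp (-(γ * Real.log p + Real.log G.card)) := by
  set w := γ * Real.log p + Real.log G.card with hw
  set m := ⨆ i : Fin n, A i j ^ 2 with hm
  have hm0 : 0 ≤ m := Real.iSup_nonneg fun i => sq_nonneg _
  have hle : ∀ i, A i j ^ 2 ≤ m := fun i =>
    le_ciSup (f := fun i : Fin n => A i j ^ 2) (Set.finite_range _).bddAbove i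
  set V := ∑ i, A i j ^ 2 * (θ i : ℝ) with hV
  have hV0 : 0 ≤ V := Finset.sum_nonneg fun i _ => mul_nonneg (sq_nonneg _) (θ i).2
  have hform : ∀ y, varTilde A G γ y j =
      varHat A y j + √(2 * (w * m) * varHat A y j) + 3 * (w * m) := by
    intro y
    rw [varTilde, ← hw, ← hm]
    ring_nf
  have hsub : {y | varTilde A G γ y j < V} ⊆
      {y | ∑ i, A i j ^ 2 * (y i : ℝ) ≤ V - √(2 * w * m * V)} := by
    intro y hy
    by_contra hc
    have hc' : V - √(2 * (w * m) * V) < varHat A y j := by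
      rw [← mul_assoc]
      exact not_le.1 hc
    have := le_add_sqrt_of_sub_sqrt_lt hV0 (varHat_nonneg A y j) (by positivity) hc'
    rw [← hform] at this
    exact absurd hy (not_lt.2 this)
  -- The Chernoff bound needs positive variance; if V = 0 the event is empty because the estimate is
  -- nonnegative.
  rcases hV0.eq_or_lt with hV1 | hV1
  · have : {y | varTilde A G γ y j < V} = ∅ := by
      refine Set.eq_empty_of_forall_notMem fun y hy => ?_
      have hy' : varTilde A G γ y j < V := hy
      rw [hform, ← hV1] at hy'
      have := varHat_nonneg A y j
      have : 0 ≤ 3 * (w * m) := by positivity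
      linarith [Real.sqrt_nonneg (2 * (w * m) * varHat A y j)]
    rw [this]
    simp [(Real.exp_pos _).le]
  · have hmpos : 0 < m := by
      refine hm0.lt_of_ne' fun h => hV1.ne' ?_
      refine Finset.sum_eq_zero fun i _ => ?_
      have : A i j ^ 2 = 0 := le_antisymm (h ▸ hle i) (sq_nonneg _)
      rw [this, zero_mul]
    exact (measureReal_mono hsub).trans
      (poissonPi_lower_tail θ (fun i => sq_nonneg _) hle hmpos hu hV1)

theorem meanVec_poissonPi (θ : Fin n → NNReal) (i : Fin n) : meanVec (poissonPi θ) i = θ i := by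
  rw [meanVec, integral_comp_eval (μ := fun i => poissonMeasure (θ i))
    (f := fun k : ℕ => (k : ℝ)) .of_discrete, integral_cast_poissonMeasure]

/-- The data-driven group weight dominates the centred group score with high probability. -/
theorem groupWeight_deviation (θ : Fin n → NNReal) (hG : G.Nonempty) {M γ : ℝ} (hγ : 0 < γ)
    (hθ0 : ∀ i, 0 < θ i) (hθM : ∀ i, (θ i : ℝ) ≤ M) (hA : groupMatrix A G ≠ 0) :
    (poissonPi θ).real {y | groupWeight A G M γ y ≤
      l2norm ((groupMatrix A G)ᵀ *ᵥ fun i => (y i : ℝ) - θ i)} ≤ 2 / (p : ℝ) ^ γ := by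
  obtain ⟨j₀, hj₀⟩ := hG
  have hp1 : 1 ≤ p := j₀.pos
  -- For p = 1 the right-hand side is 2, whatever value Lean's division by zero gives the weight.
  rcases hp1.eq_or_lt with hp | hp
  · have hp' : (p : ℝ) = 1 := by exact_mod_cast hp.symm
    refine measureReal_le_one.trans ?_
    rw [hp']
    norm_num
  set u := γ * Real.log p with hu
  have hu0 : 0 < u := mul_pos hγ (Real.log_pos (by exact_mod_cast hp))
  have hexpu : Real.exp (-u) = 1 / (p : ℝ) ^ γ := by
    rw [Real.rpow_def_of_pos (by positivity), Real.exp_neg, hu, mul_comm, one_div]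
  have hcard : (0 : ℝ) < G.card := by exact_mod_cast Finset.card_pos.2 ⟨j₀, hj₀⟩
  have hlog : 0 ≤ Real.log G.card := Real.log_nonneg (by
    exact_mod_cast Finset.card_pos.2 ⟨j₀, hj₀⟩)
  have hexpw : Real.exp (-(u + Real.log G.card)) = Real.exp (-u) / G.card := by
    rw [neg_add, Real.exp_add, Real.exp_neg (Real.log _), Real.exp_log hcard, div_eq_mul_inv]
  obtain ⟨i₀, j₁, hij⟩ : ∃ i j, groupMatrix A G i j ≠ 0 := by
    by_contra! h
    exact hA (Matrix.ext h)
  have hq : ∀ i, 0 ≤ ∑ j, groupMatrix A G i j ^ 2 :=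
    fun i => Finset.sum_nonneg fun j _ => sq_nonneg _
  have hq0 : 0 < ∑ j, groupMatrix A G i₀ j ^ 2 :=
    (pow_pos (abs_pos.2 hij) 2).trans_le (by
      rw [sq_abs]
      exact Finset.single_le_sum (f := fun j => groupMatrix A G i₀ j ^ 2)
        (fun j _ => sq_nonneg _) (Finset.mem_univ j₁))
  have hM0 : 0 ≤ M := (θ i₀).2.trans (hθM i₀)
  have hb0 : 0 < bConst A G := by
    refine (Real.iSup_nonneg fun i => Real.sqrt_nonneg _).lt_of_ne' fun h => ?_
    have := sum_sq_le_bConst_sq A G i₀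
    rw [bConst, h] at this
    linarith
  have hVpos : 0 < ∑ i, θ i * ∑ j, groupMatrix A G i j ^ 2 :=
    (mul_pos (NNReal.coe_pos.2 (hθ0 i₀)) hq0).trans_le
      (Finset.single_le_sum (f := fun i => (θ i : ℝ) * ∑ j, groupMatrix A G i j ^ 2)
        (fun i _ => mul_nonneg (θ i).2 (hq i)) (Finset.mem_univ i₀))
  have hVsum : ∑ i, θ i * ∑ j, groupMatrix A G i j ^ 2 =
      ∑ j ∈ G, ∑ i, A i j ^ 2 * (θ i : ℝ) := by
    rw [Finset.sum_comm]
    refine Finset.sum_congr rfl fun i _ => ?_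
    rw [← Finset.sum_mul, mul_comm]
    congr 1
    exact Finset.sum_coe_sort G fun j => A i j ^ 2
  have hdev := l2norm_deviation (groupMatrix A G) θ hθM hM0 (cConst_mul_le A G)
    (sum_sq_le_bConst_sq A G) hb0 hu0 hVpos
  set R := (1 + 1 / (2 * √(2 * u))) * √(∑ i, θ i * ∑ j, groupMatrix A G i j ^ 2) +
    2 * √(u * (8 * M * cConst A G ^ 2 + 16 * bConst A G ^ 2 * u)) with hR
  -- If no variance estimate falls short, the weight dominates the oracle threshold R.
  have hsub : {y : Fin n → ℕ | groupWeight A G M γ y ≤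
      l2norm ((groupMatrix A G)ᵀ *ᵥ fun i => (y i : ℝ) - θ i)} ⊆
      {y | R ≤ l2norm ((groupMatrix A G)ᵀ *ᵥ fun i => (y i : ℝ) - θ i)} ∪
        ⋃ j ∈ G, {y | varTilde A G γ y j < ∑ i, A i j ^ 2 * θ i} := by
    intro y hy
    by_cases h : ∃ j ∈ G, varTilde A G γ y j < ∑ i, A i j ^ 2 * θ i
    · obtain ⟨j, hj, h⟩ := h
      exact Or.inr (Set.mem_biUnion (s := (G : Set (Fin p))) hj h)
    · push Not at h
      refine Or.inl ?_
      change R ≤ _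
      refine le_trans ?_ hy
      have hs : √(∑ i, θ i * ∑ j, groupMatrix A G i j ^ 2) ≤ √(∑ j ∈ G, varTilde A G γ y j) := by
        rw [hVsum]
        exact Real.sqrt_le_sqrt (Finset.sum_le_sum h)
      have h2u : 2 * γ * Real.log p = 2 * u := by rw [hu]; ring
      have hDu : dConst A G M γ = 8 * M * cConst A G ^ 2 + 16 * bConst A G ^ 2 * u := by
        rw [dConst, hu]; ring
      rw [groupWeight, h2u, hDu, ← hu, hR]
      gcongr
  refine (measureReal_mono hsub).trans ((measureReal_union_le _ _).trans ?_)
  -- The log |G| in the estimate makes each of the |G| events cost exp(-u)/|G|.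
  have hun : (poissonPi θ).real (⋃ j ∈ G, {y | varTilde A G γ y j < ∑ i, A i j ^ 2 * θ i}) ≤
      Real.exp (-u) := by
    refine (measureReal_biUnion_finset_le _ _).trans ?_
    refine (Finset.sum_le_sum fun j _ =>
      varTilde_lt_variance A G θ j (add_pos_of_pos_of_nonneg hu0 hlog)).trans (le_of_eq ?_)
    rw [Finset.sum_const, nsmul_eq_mul, ← hu, hexpw]
    field_simp
  refine (add_le_add hdev hun).trans (le_of_eq ?_)
  rw [hexpu]
  ring

end Design

end PoissonGroupLasso

/-! ### Transfer to the conditional law given the design -/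

/-- Expectations and probabilities are conditional on the design: they are taken under the
conditional law `condDistrib Y X P x` of the counts, at almost every design `x`. -/
theorem theorem2 {Ω : Type*} [MeasurableSpace Ω] (P : Measure Ω) [IsProbabilityMeasure P]
    {n d p K : ℕ} (f₀ : (Fin d → ℝ) → ℝ) (φ : Fin p → (Fin d → ℝ) → ℝ)
    (X : Ω → Fin n → Fin d → ℝ) (Y : Ω → Fin n → ℕ)
    (hpos : ∀ t ∈ Set.Icc (0 : Fin d → ℝ) 1, 0 < f₀ t)
    (hmodel : PoissonGroupLasso.IsPoissonRegression P f₀ X Y)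
    (G : Fin K → Finset (Fin p)) (hG_nonempty : ∀ k, (G k).Nonempty)
    (hG_disjoint : Pairwise fun k l => Disjoint (G k) (G l))
    (hG_cover : ∀ j : Fin p, ∃ k, j ∈ G k)
    (k : Fin K) (γ : ℝ) (hγ : 0 < γ)
    (M : ℝ) (hM : 0 < M) (hf₀M : ∀ t ∈ Set.Icc (0 : Fin d → ℝ) 1, |f₀ t| ≤ M) :
    ∀ᵐ x ∂(P.map X),
      PoissonGroupLasso.groupMatrix (PoissonGroupLasso.designMatrix φ x) (G k) ≠ 0 →
      (condDistrib Y X P x).real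
          {y | PoissonGroupLasso.groupWeight (PoissonGroupLasso.designMatrix φ x) (G k) M γ y ≤
            PoissonGroupLasso.l2norm
              ((PoissonGroupLasso.groupMatrix (PoissonGroupLasso.designMatrix φ x) (G k))ᵀ *ᵥ
                fun i => (y i : ℝ) - PoissonGroupLasso.meanVec (condDistrib Y X P x) i)}
        ≤ 2 / (p : ℝ) ^ γ := by
  have hcube : ∀ᵐ x ∂(P.map X), ∀ i, x i ∈ Set.Icc (0 : Fin d → ℝ) 1 := by
    rw [ae_map_iff hmodel.measurable_design.aemeasurable]
    · exact hmodel.mem_cube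
    · have : {x : Fin n → Fin d → ℝ | ∀ i, x i ∈ Set.Icc (0 : Fin d → ℝ) 1} =
          Set.univ.pi fun _ => Set.Icc (0 : Fin d → ℝ) 1 := by
        ext
        simp only [Set.mem_univ_pi, Set.mem_ofPred_eq]
      rw [this]
      exact MeasurableSet.univ_pi fun _ => measurableSet_Icc
  filter_upwards [hcube, hmodel.condLaw] with x hx hlaw hA
  rw [hlaw]
  -- Positivity of f₀ on the cube makes the truncation `toNNReal` harmless at almost every design.
  have hθ : ∀ i, ((f₀ (x i)).toNNReal : ℝ) = f₀ (x i) := fun i =>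
    Real.coe_toNNReal _ (hpos _ (hx i)).le
  simp only [PoissonGroupLasso.meanVec_poissonPi]
  exact PoissonGroupLasso.groupWeight_deviation _ (G k) _ (hG_nonempty k) hγ
    (fun i => Real.toNNReal_pos.2 (hpos _ (hx i)))
    (fun i => (hθ i).trans_le ((le_abs_self _).trans (hf₀M _ (hx i)))) hA
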